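/- Let $L$ be a many-sorted first-order language. \emph{Positive formulas} are built from atomic formulas (including equality), $\top$ and $\bot$ using $\wedge$, $\vee$ and $\exists$. Let $T$ be a positive (that is, h-inductive) theory: a set of sentences $\forall \bar x\,(\varphi(\bar x)\to\psi(\bar x))$ with $\varphi,\psi$ positive. Assume that $T$ has the Joint Continuation Property: any two models of $T$ admit homomorphisms to a common model of $T$. Let $\mathfrak U$ be a monster model of $T$. That is, for some uncountable cardinal $\kappa$: \begin{itemize} \item $\mathfrak U$ is a positively existentially closed model of $T$: every homomorphism from $\mathfrak U$ to a model of $T$ reflects positive formulas; \item every set of positive formulas in fewer than $\kappa$ variables, over fewer than $\kappa$ parameters, that is finitely satisfiable in $\mathfrak U$ is satisfiable in $\mathfrak U$; \item any two tuples of length $<\kappa$ with the same positive type are conjugate under an automorphism of $\mathfrak U$. \end{itemize} ``Small'' means of cardinality $<\kappa$. Let $\mathcal L$ be a (one-sorted) language, let $I,J$ be $\mathcal L$-structures, and let $a=(a_i)_{i\in I}$ and $b=(b_j)_{j\in J}$ be families of tuples of $\mathfrak U$, all in the same cartesian product of sorts. Let $E\subseteq\mathfrak U$. \begin{itemize} \item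 $\mathrm{EM}_{\mathcal L}(a/E)$ is the set of positive formulas $\varphi(x_{\bar\eta})$ over $E$, with $\bar\eta$ a finite tuple from $I$, such that $\models\varphi(a_{\bar\xi})$ for every tuple $\bar\xi$ from $I$ with the same quantifier-free $\mathcal L$-type as $\bar\eta$. \item $a$ is \emph{$\mathcal L$-indiscernible over $E$} if $\mathrm{EM}_{\mathcal L}(a/E)=\mathrm{tp}(a/E)$, where $\mathrm{tp}(a/E)$ is the set of all positive formulas $\varphi(x_{\bar\eta})$ over $E$, with $\bar\eta$ a finite tuple from $I$, such that $\models\varphi(a_{\bar\eta})$. \item $b$ is \emph{$\mathrm{EM}_{\mathcal L}$-based on $a$ over $E$} if, for all $\varphi(x_{\bar\eta})\in\mathrm{EM}_{\mathcal L}(a/E)$ and all $\bar\xi$ from $J$ with the same quantifier-free $\mathcal L$-type as $\bar\eta$, we have $\varphi(x_{\bar\xi})\in\mathrm{EM}_{\mathcal L}(b/E)$. \end{itemize} Let $\mathcal L_{\mathrm{ar}}=\{<_1,<_2\}$, interpreted in $\omega\times\omega$ by $(i,j)<_1(i',j')$ iff $i<i'$, and $(i,j)<_2(i',j')$ iff $i=i'$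 and $j<j'$. \emph{Strongly indiscernible} means $\mathcal L_{\mathrm{ar}}$-indiscernible, and $\mathrm{EM}_{\mathrm{ar}}$ means $\mathrm{EM}_{\mathcal L_{\mathrm{ar}}}$. \textbf{Theorem (Array Modelling).} Let $(a_{ij})_{i,j<\omega}$ be an array of compatible small tuples of $\mathfrak U$ (that is, all $a_{ij}$ belong to the same cartesian product of sorts) and let $E\subseteq\mathfrak U$ be a small set of parameters. Then there is an array $(b_{ij})_{i,j<\omega}$ in the same cartesian product of sorts that is strongly indiscernible over $E$ and $\mathrm{EM}_{\mathrm{ar}}$-based on $(a_{ij})_{i,j<\omega}$ over $E$. -/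

import Mathlib

universe u v w

/-! ### Many-sorted positive logic -/

/-- A many-sorted language: sorts, sorted function symbols and sorted relation symbols. -/
structure SortedLanguage where
  Sorts : Type u
  /-- `Functions n d s`: the `n`-ary function symbols `d 0 × ⋯ × d (n-1) → s`. -/
  Functions : (n : ℕ) → (Fin n → Sorts) → Sorts → Type u
  /-- `Relations n d`: the `n`-ary relation symbols on `d 0 × ⋯ × d (n-1)`. -/
  Relations : (n : ℕ) → (Fin n → Sorts) → Type u

namespace SortedLanguage

/-- Combine assignments of values to two families of sorted variables. -/
def sumAssign {S : Type u} {M : S → Type v} {X : Type*} {Y : Type*} {f : X → S} {g : Y → S}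
    (a : ∀ x, M (f x)) (b : ∀ y, M (g y)) : ∀ z : X ⊕ Y, M (Sum.elim f g z)
  | Sum.inl x => a x
  | Sum.inr y => b y

/-- Terms of sort `s`, with variables `x : X` of sort `σ x`. -/
inductive Term (L : SortedLanguage.{u}) {X : Type v} (σ : X → L.Sorts) : L.Sorts → Type (max u v)
  | var (x : X) : Term L σ (σ x)
  | func {n : ℕ} {d : Fin n → L.Sorts} {s : L.Sorts} (f : L.Functions n d s)
      (ts : ∀ i, Term L σ (d i)) : Term L σ s

/-- Positive formulas with free variables `x : X` of sort `σ x`, in a context `Γ` of variables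
awaiting quantification (the most recently bound one comes first): built from
atomic formulas (including equality), `⊤` and `⊥` by `∧`, `∨` and `∃`. -/
inductive PosFormulaIn (L : SortedLanguage.{u}) {X : Type v} (σ : X → L.Sorts) :
    List L.Sorts → Type (max u v)
  | top {Γ : List L.Sorts} : PosFormulaIn L σ Γ
  | bot {Γ : List L.Sorts} : PosFormulaIn L σ Γ
  | equal {Γ : List L.Sorts} {s : L.Sorts} (t₁ t₂ : L.Term (Sum.elim σ Γ.get) s) :
      PosFormulaIn L σ Γ
  | rel {Γ : List L.Sorts} {n : ℕ} {d : Fin n → L.Sorts} (R : L.Relations n d)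
      (ts : ∀ i, L.Term (Sum.elim σ Γ.get) (d i)) : PosFormulaIn L σ Γ
  | and {Γ : List L.Sorts} (φ ψ : PosFormulaIn L σ Γ) : PosFormulaIn L σ Γ
  | or {Γ : List L.Sorts} (φ ψ : PosFormulaIn L σ Γ) : PosFormulaIn L σ Γ
  | ex {Γ : List L.Sorts} (s : L.Sorts) (φ : PosFormulaIn L σ (s :: Γ)) : PosFormulaIn L σ Γ

/-- Positive formulas with free variables `x : X` of sort `σ x`. -/
abbrev PosFormula (L : SortedLanguage.{u}) {X : Type v} (σ : X → L.Sorts) : Type (max u v) :=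
  L.PosFormulaIn σ []

/-- Many-sorted structures. -/
structure Str (L : SortedLanguage.{u}) where
  carrier : L.Sorts → Type u
  funMap : ∀ {n : ℕ} {d : Fin n → L.Sorts} {s : L.Sorts}, L.Functions n d s →
    (∀ i, carrier (d i)) → carrier s
  relMap : ∀ {n : ℕ} {d : Fin n → L.Sorts}, L.Relations n d → (∀ i, carrier (d i)) → Prop

variable {L : SortedLanguage.{u}}

def Term.realize (M : L.Str) {X : Type v} {σ : X → L.Sorts} (a : ∀ x, M.carrier (σ x)) :
    {s : L.Sorts} → L.Term σ s → M.carrier s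
  | _, .var x => a x
  | _, .func f ts => M.funMap f (fun i => (ts i).realize M a)

def PosFormulaIn.realize (M : L.Str) {X : Type v} {σ : X → L.Sorts}
    (a : ∀ x, M.carrier (σ x)) :
    {Γ : List L.Sorts} → L.PosFormulaIn σ Γ → (∀ i, M.carrier (Γ.get i)) → Prop
  | _, .top, _ => True
  | _, .bot, _ => False
  | _, .equal t₁ t₂, c => t₁.realize M (sumAssign a c) = t₂.realize M (sumAssign a c)
  | _, .rel R ts, c => M.relMap R (fun i => (ts i).realize M (sumAssign a c))
  | _, .and φ ψ, c => φ.realize M a c ∧ ψ.realize M a c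
  | _, .or φ ψ, c => φ.realize M a c ∨ ψ.realize M a c
  | Γ, .ex s φ, c => ∃ y : M.carrier s,
      φ.realize M a (Fin.cons (α := fun i => M.carrier ((s :: Γ).get i)) y c)

/-- `M ⊨ φ(a)`. -/
def Str.Sat (M : L.Str) {X : Type v} {σ : X → L.Sorts} (φ : L.PosFormula σ)
    (a : ∀ x, M.carrier (σ x)) : Prop :=
  φ.realize M a (fun i => i.elim0)

/-- Homomorphisms. -/
structure Hom (M N : L.Str) where
  toFun : ∀ s, M.carrier s → N.carrier s
  map_fun : ∀ {n : ℕ} {d : Fin n → L.Sorts} {s : L.Sorts} (f : L.Functions n d s)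
    (x : ∀ i, M.carrier (d i)), toFun s (M.funMap f x) = N.funMap f (fun i => toFun _ (x i))
  map_rel : ∀ {n : ℕ} {d : Fin n → L.Sorts} (R : L.Relations n d)
    (x : ∀ i, M.carrier (d i)), M.relMap R x → N.relMap R (fun i => toFun _ (x i))

/-- Immersions: homomorphisms that reflect positive formulas. -/
def Hom.IsImmersion {M N : L.Str} (f : Hom M N) : Prop :=
  ∀ (n : ℕ) (σ : Fin n → L.Sorts) (φ : L.PosFormula σ) (a : ∀ i, M.carrier (σ i)),
    N.Sat φ (fun i => f.toFun _ (a i)) → M.Sat φ a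

/-- Automorphisms: endomorphisms with a two-sided inverse endomorphism. -/
def Hom.IsAut {M : L.Str} (f : Hom M M) : Prop :=
  ∃ g : Hom M M, (∀ s x, g.toFun s (f.toFun s x) = x) ∧ ∀ s x, f.toFun s (g.toFun s x) = x

/-- An h-inductive sentence `∀ x, (hyp x → concl x)` with `hyp`, `concl` positive. -/
structure HInductive (L : SortedLanguage.{u}) where
  n : ℕ
  sort : Fin n → L.Sorts
  hyp : L.PosFormula sort
  concl : L.PosFormula sort

/-- Positive (i.e. h-inductive) theories. -/
abbrev PosTheory (L : SortedLanguage.{u}) := Set L.HInductive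

namespace PosTheory

def IsModel (T : L.PosTheory) (M : L.Str) : Prop :=
  ∀ χ ∈ T, ∀ a : ∀ i, M.carrier (χ.sort i), M.Sat χ.hyp a → M.Sat χ.concl a

/-- Positively existentially closed models. -/
def IsPec (T : L.PosTheory) (M : L.Str) : Prop :=
  T.IsModel M ∧ ∀ N : L.Str, T.IsModel N → ∀ f : Hom M N, f.IsImmersion

/-- The Joint Continuation Property. -/
def JCP (T : L.PosTheory) : Prop :=
  ∀ M N : L.Str, T.IsModel M → T.IsModel N →
    ∃ P : L.Str, T.IsModel P ∧ Nonempty (Hom M P) ∧ Nonempty (Hom N P)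

end PosTheory

/-! ### Parameters, saturation, homogeneity -/

/-- A set of parameters from `M` (of arbitrary sorts). -/
abbrev Str.Params (M : L.Str) := Set (Σ s, M.carrier s)

/-- The sorts of variables `x : X` together with the parameters in `A`. -/
def Str.paramSort (M : L.Str) {X : Type v} (σ : X → L.Sorts) (A : M.Params) :
    X ⊕ A → L.Sorts :=
  Sum.elim σ (fun e => e.1.1)

/-- Positive formulas over `A`. -/
abbrev Str.FormulaOver (M : L.Str) {X : Type v} (σ : X → L.Sorts) (A : M.Params) :=
  L.PosFormula (M.paramSort σ A)

/-- `M ⊨ φ(a)` for `φ` over `A`: each parameter is interpreted as itself. -/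
def Str.SatOver (M : L.Str) {X : Type v} {σ : X → L.Sorts} {A : M.Params}
    (φ : M.FormulaOver σ A) (a : ∀ x, M.carrier (σ x)) : Prop :=
  M.Sat φ (sumAssign a (fun e => e.1.2))

/-- Every set of positive formulas in fewer than `κ` variables, over fewer than `κ` parameters,
that is finitely satisfiable in `M` is satisfiable in `M`. -/
def Str.IsSaturated (M : L.Str) (κ : Cardinal.{u}) : Prop :=
  ∀ (X : Type u) (σ : X → L.Sorts) (A : M.Params), Cardinal.mk X < κ → Cardinal.mk A < κ →
    ∀ p : Set (M.FormulaOver σ A),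
      (∀ q ⊆ p, q.Finite → ∃ a : ∀ x, M.carrier (σ x), ∀ φ ∈ q, M.SatOver φ a) →
        ∃ a : ∀ x, M.carrier (σ x), ∀ φ ∈ p, M.SatOver φ a

/-- Any two tuples of length `< κ` with the same positive type are conjugate. -/
def Str.IsHomogeneous (M : L.Str) (κ : Cardinal.{u}) : Prop :=
  ∀ (X : Type u) (σ : X → L.Sorts), Cardinal.mk X < κ → ∀ a b : ∀ x, M.carrier (σ x),
    (∀ φ : L.PosFormula σ, M.Sat φ a ↔ M.Sat φ b) →
      ∃ f : Hom M M, f.IsAut ∧ ∀ x, f.toFun _ (a x) = b x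

/-- `M` is a monster model of `T`, where "small" means "of cardinality less than `κ`". -/
structure PosTheory.IsMonster (T : L.PosTheory) (κ : Cardinal.{u}) (M : L.Str) : Prop where
  uncountable : Cardinal.aleph0 < κ
  pec : T.IsPec M
  saturated : M.IsSaturated κ
  homogeneous : M.IsHomogeneous κ

/-! ### Generalised indiscernibles -/

open FirstOrder in
/-- The finite tuples `η` of `I` and `ξ` of `J` have the same quantifier-free type. -/
def SameQfType (L' : FirstOrder.Language) {I J : Type*} [L'.Structure I] [L'.Structure J]
    {n : ℕ} (η : Fin n → I) (ξ : Fin n → J) : Prop :=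
  ∀ θ : L'.Formula (Fin n), FirstOrder.Language.BoundedFormula.IsQF θ →
    (θ.Realize η ↔ θ.Realize ξ)

/-- A formula `φ(x_η)` over `A`, for a finite tuple `η` from the index set `I`, where each
`x_i` is a tuple of variables `(x_{i,k})_{k : K}` with `x_{i,k}` of sort `σ k`. -/
structure IndexedFormula (M : L.Str) (I : Type w) {K : Type v} (σ : K → L.Sorts)
    (A : M.Params) where
  n : ℕ
  η : Fin n → I
  φ : M.FormulaOver (fun p : Fin n × K => σ p.2) A

variable {M : L.Str} {I J : Type*} {K : Type v} {σ : K → L.Sorts}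

/-- `⊨ φ(a_η)`, where `(a i)_{i : I}` are tuples in the product over `k : K` of the
sorts `σ k`. -/
def IndexedFormula.Holds {A : M.Params} (p : IndexedFormula M I σ A)
    (a : I → ∀ k, M.carrier (σ k)) : Prop :=
  M.SatOver p.φ (fun q => a (p.η q.1) q.2)

/-- The type of `(a i)_{i : I}` over `A`. -/
def tp (a : I → ∀ k, M.carrier (σ k)) (A : M.Params) : Set (IndexedFormula M I σ A) :=
  {p | p.Holds a}

/-- The `EM`-type of `(a i)_{i : I}` over `A`, for `I` an `L'`-structure. -/
def EM (L' : FirstOrder.Language) [L'.Structure I] (a : I → ∀ k, M.carrier (σ k))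
    (A : M.Params) : Set (IndexedFormula M I σ A) :=
  {p | ∀ ξ : Fin p.n → I, SameQfType L' p.η ξ → IndexedFormula.Holds ⟨p.n, ξ, p.φ⟩ a}

/-- `(a i)_{i : I}` is `L'`-indiscernible over `A`. -/
def IsIndiscernible (L' : FirstOrder.Language) [L'.Structure I]
    (a : I → ∀ k, M.carrier (σ k)) (A : M.Params) : Prop :=
  EM L' a A = tp a A

/-- `(b j)_{j : J}` is `EM`-based on `(a i)_{i : I}` over `A`. -/
def IsEMBased (L' : FirstOrder.Language) [L'.Structure I] [L'.Structure J]
    (b : J → ∀ k, M.carrier (σ k)) (a : I → ∀ k, M.carrier (σ k)) (A : M.Params) : Prop :=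
  ∀ p ∈ EM L' a A, ∀ ξ : Fin p.n → J, SameQfType L' p.η ξ →
    (⟨p.n, ξ, p.φ⟩ : IndexedFormula M J σ A) ∈ EM L' b A

/-! ### Arrays -/

/-- The two binary relation symbols `<₁` and `<₂`. -/
inductive ArRel : ℕ → Type
  | lt₁ : ArRel 2
  | lt₂ : ArRel 2

/-- The language of arrays. -/
def Lar : FirstOrder.Language := ⟨fun _ => Empty, ArRel⟩

/-- On `I × J`, `<₁` is the order on rows and `<₂` is the order internal to rows. -/
instance arStructure (I J : Type*) [LinearOrder I] [LinearOrder J] : Lar.Structure (I × J) where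
  funMap := fun f _ => Empty.elim f
  RelMap := fun R x => match R, x with
    | ArRel.lt₁, x => (x 0).1 < (x 1).1
    | ArRel.lt₂, x => (x 0).1 = (x 1).1 ∧ (x 0).2 < (x 1).2

/-- Strongly indiscernible (that is, array-indiscernible) over `A`. -/
def IsStronglyIndiscernible {I J : Type*} [LinearOrder I] [LinearOrder J]
    (a : I × J → ∀ k, M.carrier (σ k)) (A : M.Params) : Prop :=
  IsIndiscernible Lar a A

end SortedLanguage

namespace SortedLanguage

variable {L : SortedLanguage.{u}}

/-! ### Renaming variables, supports and projections -/

theorem Term.exists_rename {X : Type v} {Y : Type w} {σ : X → L.Sorts} {τ : Y → L.Sorts} (ρ : X → Y)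
    (hρ : ∀ x, τ (ρ x) = σ x) {s : L.Sorts} (t : L.Term σ s) :
    ∃ t' : L.Term τ s, ∀ (M : L.Str) (a : ∀ x, M.carrier (σ x)) (b : ∀ y, M.carrier (τ y)),
      (∀ x, HEq (a x) (b (ρ x))) → t'.realize M b = t.realize M a := by
  induction t with
  | var x =>
    have key : ∀ s, τ (ρ x) = s → ∃ t' : L.Term τ s, ∀ (M : L.Str) (v : M.carrier s)
        (b : ∀ y, M.carrier (τ y)), HEq v (b (ρ x)) → t'.realize M b = v := by
      rintro _ rfl
      exact ⟨.var (ρ x), fun M v b h => (eq_of_heq h).symm⟩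
    obtain ⟨t', ht'⟩ := key _ (hρ x)
    exact ⟨t', fun M a b h => ht' M (a x) b (h x)⟩
  | func f ts ih =>
    choose ts' hts' using ih
    refine ⟨.func f ts', fun M a b h => ?_⟩
    simp only [Term.realize]
    congr 1
    funext i
    exact hts' i M a b h

/-- Sorts match only propositionally, so the renamed formula is given by its semantics, with `HEq`
in place of casts. The map `ρ` may mix free and context variables, so that a free variable can be
moved into the context and then quantified. -/
theorem PosFormulaIn.exists_rename {X : Type v} {Y : Type w} {σ : X → L.Sorts} {τ : Y → L.Sorts}
    {Γ : List L.Sorts} (φ : L.PosFormulaIn σ Γ) : ∀ {Δ : List L.Sorts}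
      (ρ : X ⊕ Fin Γ.length → Y ⊕ Fin Δ.length)
      (_ : ∀ z, Sum.elim τ Δ.get (ρ z) = Sum.elim σ Γ.get z),
      ∃ φ' : L.PosFormulaIn τ Δ, ∀ (M : L.Str) (a : ∀ x, M.carrier (σ x))
        (c : ∀ i, M.carrier (Γ.get i)) (b : ∀ y, M.carrier (τ y))
        (d : ∀ i, M.carrier (Δ.get i)),
        (∀ z, HEq (sumAssign a c z) (sumAssign b d (ρ z))) →
          (φ'.realize M b d ↔ φ.realize M a c) := by
  induction φ with
  | top => exact fun _ _ => ⟨.top, fun _ _ _ _ _ _ => Iff.rfl⟩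
  | bot => exact fun _ _ => ⟨.bot, fun _ _ _ _ _ _ => Iff.rfl⟩
  | equal t₁ t₂ =>
    intro Δ ρ hρ
    obtain ⟨t₁', h₁⟩ := t₁.exists_rename ρ hρ
    obtain ⟨t₂', h₂⟩ := t₂.exists_rename ρ hρ
    refine ⟨.equal t₁' t₂', fun M a c b d h => ?_⟩
    simp only [PosFormulaIn.realize, h₁ M _ _ h, h₂ M _ _ h]
  | rel R ts =>
    intro Δ ρ hρ
    choose ts' hts' using fun i => (ts i).exists_rename ρ hρ
    refine ⟨.rel R ts', fun M a c b d h => ?_⟩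
    simp only [PosFormulaIn.realize, fun i => hts' i M _ _ h]
  | and φ ψ ihφ ihψ =>
    intro Δ ρ hρ
    obtain ⟨φ', h₁⟩ := ihφ ρ hρ
    obtain ⟨ψ', h₂⟩ := ihψ ρ hρ
    exact ⟨.and φ' ψ', fun M a c b d h => and_congr (h₁ M _ _ _ _ h) (h₂ M _ _ _ _ h)⟩
  | or φ ψ ihφ ihψ =>
    intro Δ ρ hρ
    obtain ⟨φ', h₁⟩ := ihφ ρ hρ
    obtain ⟨ψ', h₂⟩ := ihψ ρ hρ
    exact ⟨.or φ' ψ', fun M a c b d h => or_congr (h₁ M _ _ _ _ h) (h₂ M _ _ _ _ h)⟩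
  | @ex Γ s φ ih =>
    intro Δ ρ hρ
    let lift : Y ⊕ Fin Δ.length → Y ⊕ Fin (s :: Δ).length := Sum.map id Fin.succ
    have hlift : ∀ z, Sum.elim τ (s :: Δ).get (lift z) = Sum.elim τ Δ.get z := by
      rintro (z | z) <;> rfl
    let ρ' : X ⊕ Fin (s :: Γ).length → Y ⊕ Fin (s :: Δ).length :=
      Sum.elim (fun x => lift (ρ (.inl x)))
        (Fin.cons (α := fun _ => Y ⊕ Fin (s :: Δ).length) (.inr (0 : Fin (Δ.length + 1)))
          fun i => lift (ρ (.inr i)))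
    obtain ⟨φ', hφ'⟩ := ih (Δ := s :: Δ) ρ' (by
      rintro (x | i)
      · exact (hlift _).trans (hρ (.inl x))
      · refine Fin.cases ?_ (fun i => ?_) i
        · rfl
        · exact (hlift _).trans (hρ (.inr i)))
    refine ⟨.ex s φ', fun M a c b d h => exists_congr fun y => hφ' M _ _ _ _ ?_⟩
    have hl : ∀ z, HEq (sumAssign b (Fin.cons (α := fun i => M.carrier ((s :: Δ).get i)) y d)
        (lift z)) (sumAssign b d z) := by
      rintro (z | z) <;> exact HEq.rfl
    rintro (x | i)
    · exact (h (.inl x)).trans (hl _).symm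
    · refine Fin.cases ?_ (fun i => ?_) i
      · exact HEq.rfl
      · exact (h (.inr i)).trans (hl _).symm

theorem PosFormula.exists_rename {X : Type v} {Y : Type w} {σ : X → L.Sorts} {τ : Y → L.Sorts}
    (φ : L.PosFormula σ) (ρ : X → Y) (hρ : ∀ x, τ (ρ x) = σ x) :
    ∃ φ' : L.PosFormula τ, ∀ (M : L.Str) (a : ∀ x, M.carrier (σ x))
      (b : ∀ y, M.carrier (τ y)), (∀ x, HEq (a x) (b (ρ x))) → (M.Sat φ' b ↔ M.Sat φ a) := by
  obtain ⟨φ', h⟩ := PosFormulaIn.exists_rename φ (τ := τ) (Δ := []) (Sum.map ρ id) (by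
    rintro (x | i)
    · exact hρ x
    · exact i.elim0)
  refine ⟨φ', fun M a b hab => h M _ _ _ _ ?_⟩
  rintro (x | i)
  · exact hab x
  · exact i.elim0

theorem Term.exists_support {X : Type v} {σ : X → L.Sorts} {Γ : List L.Sorts} {s : L.Sorts}
    (t : L.Term (Sum.elim σ Γ.get) s) : ∃ F : Set X, F.Finite ∧ ∀ (M : L.Str)
      (a b : ∀ x, M.carrier (σ x)) (c : ∀ i, M.carrier (Γ.get i)),
      (∀ x ∈ F, a x = b x) → t.realize M (sumAssign a c) = t.realize M (sumAssign b c) := by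
  induction t with
  | var z =>
    rcases z with x | i
    · exact ⟨{x}, Set.finite_singleton x, fun M a b c h => h x rfl⟩
    · exact ⟨∅, Set.finite_empty, fun M a b c h => rfl⟩
  | func f ts ih =>
    choose F hF h using ih
    refine ⟨⋃ i, F i, Set.finite_iUnion hF, fun M a b c hab => ?_⟩
    simp only [Term.realize]
    congr 1
    funext i
    exact h i M a b c fun x hx => hab x (Set.mem_iUnion_of_mem i hx)

/-- Finiteness of the support makes quantification over an infinite set of variables expressible by
finitely many quantifiers. -/
theorem PosFormulaIn.exists_support {X : Type v} {σ : X → L.Sorts} {Γ : List L.Sorts}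
    (φ : L.PosFormulaIn σ Γ) : ∃ F : Set X, F.Finite ∧ ∀ (M : L.Str)
      (a b : ∀ x, M.carrier (σ x)) (c : ∀ i, M.carrier (Γ.get i)),
      (∀ x ∈ F, a x = b x) → (φ.realize M a c ↔ φ.realize M b c) := by
  induction φ with
  | top => exact ⟨∅, Set.finite_empty, fun _ _ _ _ _ => Iff.rfl⟩
  | bot => exact ⟨∅, Set.finite_empty, fun _ _ _ _ _ => Iff.rfl⟩
  | equal t₁ t₂ =>
    obtain ⟨F₁, hF₁, h₁⟩ := t₁.exists_support
    obtain ⟨F₂, hF₂, h₂⟩ := t₂.exists_support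
    refine ⟨F₁ ∪ F₂, hF₁.union hF₂, fun M a b c h => ?_⟩
    simp only [PosFormulaIn.realize, h₁ M a b c fun x hx => h x (.inl hx),
      h₂ M a b c fun x hx => h x (.inr hx)]
  | rel R ts =>
    choose F hF hts using fun i => (ts i).exists_support
    refine ⟨⋃ i, F i, Set.finite_iUnion hF, fun M a b c h => ?_⟩
    simp only [PosFormulaIn.realize,
      fun i => hts i M a b c fun x hx => h x (Set.mem_iUnion_of_mem i hx)]
  | and φ ψ ihφ ihψ =>
    obtain ⟨F₁, hF₁, h₁⟩ := ihφ
    obtain ⟨F₂, hF₂, h₂⟩ := ihψ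
    exact ⟨F₁ ∪ F₂, hF₁.union hF₂, fun M a b c h =>
      and_congr (h₁ M a b c fun x hx => h x (.inl hx)) (h₂ M a b c fun x hx => h x (.inr hx))⟩
  | or φ ψ ihφ ihψ =>
    obtain ⟨F₁, hF₁, h₁⟩ := ihφ
    obtain ⟨F₂, hF₂, h₂⟩ := ihψ
    exact ⟨F₁ ∪ F₂, hF₁.union hF₂, fun M a b c h =>
      or_congr (h₁ M a b c fun x hx => h x (.inl hx)) (h₂ M a b c fun x hx => h x (.inr hx))⟩
  | ex s φ ih =>
    obtain ⟨F, hF, h⟩ := ih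
    exact ⟨F, hF, fun M a b c hab => exists_congr fun y => h M a b _ hab⟩

open Classical in
theorem PosFormula.exists_ex {X : Type v} {σ : X → L.Sorts} (φ : L.PosFormula σ) (y : X) :
    ∃ φ' : L.PosFormula σ, ∀ (M : L.Str) (a : ∀ x, M.carrier (σ x)),
      M.Sat φ' a ↔ ∃ v, M.Sat φ (Function.update a y v) := by
  obtain ⟨φ', h⟩ := PosFormulaIn.exists_rename φ (τ := σ) (Δ := [σ y])
    (Sum.elim (fun x => if x = y then .inr 0 else .inl x) fun i => i.elim0) (by
      rintro (x | i)
      · by_cases hx : x = y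
        · subst hx; simp
        · simp [hx]
      · exact i.elim0)
  refine ⟨.ex (σ y) φ', fun M a => exists_congr fun v => h M _ _ _ _ ?_⟩
  have h₀ : ∀ w : X ⊕ Fin [σ y].length, w = .inr 0 → HEq v (sumAssign a
      (Fin.cons (α := fun i => M.carrier ([σ y].get i)) v fun i => i.elim0) w) := by
    rintro _ rfl
    exact HEq.rfl
  have h₁ : ∀ x (w : X ⊕ Fin [σ y].length), w = .inl x → HEq (a x) (sumAssign a
      (Fin.cons (α := fun i => M.carrier ([σ y].get i)) v fun i => i.elim0) w) := by
    rintro x _ rfl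
    exact HEq.rfl
  rintro (x | i)
  · by_cases hx : x = y
    · subst hx
      simp only [sumAssign, Function.update_self]
      exact h₀ _ (if_pos rfl)
    · simp only [sumAssign]
      rw [Function.update_of_ne hx]
      exact h₁ x _ (if_neg hx)
  · exact i.elim0

theorem PosFormula.exists_ex_of_finite {X : Type v} {σ : X → L.Sorts} {F : Set X}
    (hF : F.Finite) (φ : L.PosFormula σ) :
    ∃ φ' : L.PosFormula σ, ∀ (M : L.Str) (a : ∀ x, M.carrier (σ x)),
      M.Sat φ' a ↔ ∃ b : ∀ x, M.carrier (σ x), (∀ x ∉ F, b x = a x) ∧ M.Sat φ b := by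
  classical
  induction F, hF using Set.Finite.induction_on generalizing φ with
  | empty =>
    refine ⟨φ, fun M a => ⟨fun h => ⟨a, fun _ _ => rfl, h⟩, ?_⟩⟩
    rintro ⟨b, hb, h⟩
    rwa [show a = b from funext fun x => (hb x (Set.notMem_empty x)).symm]
  | @insert y F hy hF ih =>
    obtain ⟨φ₁, h₁⟩ := φ.exists_ex y
    obtain ⟨φ₂, h₂⟩ := ih φ₁
    refine ⟨φ₂, fun M a => ?_⟩
    rw [h₂]
    constructor
    · rintro ⟨b, hb, h⟩
      obtain ⟨v, hv⟩ := (h₁ M b).1 h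
      refine ⟨_, fun x hx => ?_, hv⟩
      rw [Set.mem_insert_iff, not_or] at hx
      rw [Function.update_of_ne hx.1, hb x hx.2]
    · rintro ⟨b, hb, h⟩
      refine ⟨Function.update b y (a y), fun x hx => ?_, (h₁ M _).2 ⟨b y, ?_⟩⟩
      · by_cases hxy : x = y
        · subst hxy; simp
        · rw [Function.update_of_ne hxy]
          exact hb x (by simp [hxy, hx])
      · simpa using h

/-- Positive formulas are closed under projection onto an arbitrary set `S` of variables. -/
theorem PosFormula.exists_project {X : Type v} {σ : X → L.Sorts} (φ : L.PosFormula σ)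
    (S : Set X) :
    ∃ φ' : L.PosFormula σ, ∀ (M : L.Str) (a : ∀ x, M.carrier (σ x)),
      M.Sat φ' a ↔ ∃ b : ∀ x, M.carrier (σ x), (∀ x ∈ S, b x = a x) ∧ M.Sat φ b := by
  classical
  obtain ⟨F, hF, h⟩ := PosFormulaIn.exists_support φ
  obtain ⟨φ', h'⟩ := PosFormula.exists_ex_of_finite (hF.sdiff (t := S)) φ
  refine ⟨φ', fun M a => ?_⟩
  rw [h']
  constructor
  · rintro ⟨b, hb, hφ⟩
    exact ⟨b, fun x hx => hb x fun hx' => hx'.2 hx, hφ⟩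
  · rintro ⟨b, hb, hφ⟩
    refine ⟨fun x => if x ∈ F \ S then b x else a x, fun x hx => if_neg hx,
      (h M _ _ _ fun x hx => ?_).2 hφ⟩
    by_cases hxS : x ∈ S
    · simp [hxS, hb x hxS]
    · simp [hx, hxS]

theorem PosFormula.exists_conj {X : Type v} {σ : X → L.Sorts} {ι : Type*} (s : Finset ι)
    (f : ι → L.PosFormula σ) :
    ∃ φ : L.PosFormula σ, ∀ (M : L.Str) (a : ∀ x, M.carrier (σ x)),
      M.Sat φ a ↔ ∀ i ∈ s, M.Sat (f i) a := by
  classical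
  induction s using Finset.induction_on with
  | empty => exact ⟨.top, fun M a => by simp [Str.Sat, PosFormulaIn.realize]⟩
  | insert i s _ ih =>
    obtain ⟨φ, h⟩ := ih
    refine ⟨.and (f i) φ, fun M a => ?_⟩
    rw [Finset.forall_mem_insert, ← h]
    rfl

end SortedLanguage

/-! ### A partition theorem for infinitely many colours -/

/-- The end-homogeneous step of Erdős–Rado. For each `δ`, choose by recursion the least point above
the earlier ones that has the same colours as `δ` over them. If some `δ` is never reached, it works.
Otherwise `δ` is determined by the stage at which it is reached and by its colours over its own
branch, and `X` has too many points for that. -/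
theorem exists_endHomogeneous {Λ : Type v} {C : Type u} [LinearOrder Λ] [WellFoundedLT Λ] (m : ℕ)
    {X : Type (max u v)} [LinearOrder X] [WellFoundedLT X]
    (hX : Cardinal.mk (Λ × ((Fin m → Λ) → C)) < Cardinal.mk X) (c : (Fin (m + 1) → X) → C) :
    ∃ (h : Λ → X) (δ : X), StrictMono h ∧ ∀ (z : Fin m → Λ) (y : Λ), (∀ i, z i < y) →
      c (Fin.snoc (h ∘ z) (h y)) = c (Fin.snoc (h ∘ z) δ) := by
  classical
  -- `S δ x g`: the points which extend `g` on the initial segment below `x` in the way `δ` does.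
  let S : X → (x : Λ) → (∀ y, y < x → X) → Set X := fun δ x g =>
    {t | (∀ y (hy : y < x), g y hy < t) ∧ ∀ (z : Fin m → Λ) (hz : ∀ i, z i < x),
      c (Fin.snoc (fun i => g (z i) (hz i)) t : Fin (m + 1) → X) =
        c (Fin.snoc (fun i => g (z i) (hz i)) δ : Fin (m + 1) → X)}
  -- The default value is immaterial: while all earlier values are below `δ`, the point `δ` is
  -- itself a candidate.
  let h : X → Λ → X := fun δ => wellFounded_lt.fix fun x g =>
    if hS : (S δ x g).Nonempty then wellFounded_lt.min (S δ x g) hS else δ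
  have h_eq : ∀ δ x, h δ x = if hS : (S δ x fun y _ => h δ y).Nonempty then
      wellFounded_lt.min (S δ x fun y _ => h δ y) hS else δ :=
    fun δ x => wellFounded_lt.fix_eq _ x
  have hmem : ∀ δ x, (∀ y < x, h δ y < δ) → δ ∈ S δ x fun y _ => h δ y :=
    fun δ x hx => ⟨hx, fun _ _ => rfl⟩
  have hspec : ∀ δ x, (∀ y < x, h δ y < δ) → h δ x ∈ S δ x (fun y _ => h δ y) ∧ h δ x ≤ δ := by
    intro δ x hx
    have hS := hmem δ x hx
    rw [h_eq δ x, dif_pos ⟨δ, hS⟩]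
    exact ⟨wellFounded_lt.min_mem _ _, not_lt.1 (wellFounded_lt.not_lt_min _ hS)⟩
  by_cases hδ : ∃ δ, ∀ x, h δ x < δ
  · obtain ⟨δ, hδ⟩ := hδ
    refine ⟨h δ, δ, fun x y hxy => (hspec δ y fun y _ => hδ y).1.1 x hxy, fun z y hzy => ?_⟩
    exact (hspec δ y fun y _ => hδ y).1.2 z hzy
  · exfalso
    push Not at hδ
    have hex : ∀ δ, ∃ x, h δ x = δ ∧ ∀ y < x, h δ y < δ := by
      intro δ
      obtain ⟨x, hx, hmin⟩ := wellFounded_lt.has_min {x | δ ≤ h δ x} (hδ δ)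
      have hlt : ∀ y < x, h δ y < δ := fun y hy => not_le.1 fun hle => hmin y hle hy
      exact ⟨x, le_antisymm (hspec δ x hlt).2 hx, hlt⟩
    choose ξ hξ hlt using hex
    -- The recursion consults `δ` only through its colours over earlier points, so equal data give
    -- equal branches, up to the common stage where both reach their target.
    refine (Cardinal.mk_le_of_injective (f := fun δ => (ξ δ, fun z : Fin m → Λ =>
      c (Fin.snoc (h δ ∘ z) δ))) fun δ ε hδε => ?_).not_gt hX
    obtain ⟨hx, hc⟩ := Prod.ext_iff.1 hδε
    simp only at hx hc
    have hagree : ∀ x, x ≤ ξ δ → h δ x = h ε x := by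
      intro x
      induction x using WellFoundedLT.induction with
      | _ x ih =>
        intro hxle
        have ih' : ∀ y < x, h δ y = h ε y := fun y hy => ih y hy (hy.le.trans hxle)
        have hSS : (S δ x fun y _ => h δ y) = S ε x fun y _ => h ε y := by
          ext t
          refine and_congr (forall₂_congr fun y hy => by simp only [ih' y hy])
            (forall₂_congr fun z hz => ?_)
          have hz' : (fun i => h δ (z i)) = fun i => h ε (z i) := funext fun i => ih' _ (hz i)
          have hcz := congr_fun hc z
          simp only [Function.comp_def] at hcz
          rw [hcz, hz']
        have hne := hmem δ x fun y hy => hlt δ y (hy.trans_le hxle)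
        have hne' := hSS ▸ hne
        rw [h_eq δ x, h_eq ε x, dif_pos ⟨δ, hne⟩, dif_pos ⟨δ, hne'⟩]
        congr 1
    rw [← hξ δ, hagree _ le_rfl, hx, hξ ε]

/-- A form of the Erdős–Rado theorem, without bounds. -/
theorem exists_homogeneous (W : Type w) (C : Type u) [LinearOrder W] [WellFoundedLT W] (m : ℕ) :
    ∃ (Λ : Type (max u w)) (_ : LinearOrder Λ) (_ : WellFoundedLT Λ), ∀ c : (Fin m → Λ) → C,
      ∃ h : W → Λ, StrictMono h ∧ ∀ s t : Fin m → W, StrictMono s → StrictMono t →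
        c (h ∘ s) = c (h ∘ t) := by
  induction m with
  | zero =>
    exact ⟨ULift.{u} W, inferInstance, inferInstance, fun c => ⟨ULift.up, fun _ _ => id, fun s t _ _ =>
      congr_arg c (Subsingleton.elim _ _)⟩⟩
  | succ m ih =>
    obtain ⟨Λ, _, _, hΛ⟩ := ih
    -- By Cantor, this well-order is long enough for end-homogeneity over `Λ`.
    let X := (2 ^ Cardinal.mk (Λ × ((Fin m → Λ) → C)) : Cardinal.{max u w}).ord.ToType
    refine ⟨X, inferInstance, inferInstance, fun c => ?_⟩
    obtain ⟨h, δ, hh, hend⟩ := exists_endHomogeneous.{u, max u w} m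
      (by rw [Cardinal.mk_ord_toType]; exact Cardinal.cantor _) c
    -- Along `h` the last point may be replaced by `δ`, which leaves a colouring of `m`-tuples.
    obtain ⟨g, hg, hhom⟩ := hΛ fun z => c (Fin.snoc (h ∘ z) δ)
    refine ⟨h ∘ g, hh.comp hg, ?_⟩
    have key : ∀ s : Fin (m + 1) → W, StrictMono s →
        c ((h ∘ g) ∘ s) = c (Fin.snoc (h ∘ g ∘ (s ∘ Fin.castSucc)) δ) := by
      intro s hs
      rw [← hend (g ∘ (s ∘ Fin.castSucc)) (g (s (Fin.last m)))
        fun i => hg (hs (Fin.castSucc_lt_last i))]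
      congr 1
      funext i
      refine Fin.lastCases ?_ (fun i => ?_) i <;> simp
    intro s t hs ht
    rw [key s hs, key t ht]
    exact hhom _ _ (hs.comp (Fin.strictMono_castSucc)) (ht.comp (Fin.strictMono_castSucc))

/-- Finite families in a linear order are increasing enumerations, up to a reindexing that
depends only on the order relations among the members of the family. -/
theorem exists_strictMono_reindex {A W : Type*} [Finite A] [LinearOrder W] (f : A → W) :
    ∃ (m : ℕ) (p : A → Fin m), ∀ g : A → W, (∀ x y, f x < f y ↔ g x < g y) →
      ∃ s : Fin m → W, StrictMono s ∧ ∀ x, g x = s (p x) := by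
  classical
  have := Fintype.ofFinite A
  let T := Finset.univ.image f
  let e := T.orderIsoOfFin rfl
  have hf : ∀ x, f x ∈ T := fun x => Finset.mem_image_of_mem f (Finset.mem_univ x)
  let p : A → Fin T.card := fun x => e.symm ⟨f x, hf x⟩
  have hp : ∀ x y, p x < p y ↔ f x < f y := fun x y => e.symm.lt_iff_lt
  refine ⟨T.card, p, fun g hg => ?_⟩
  have hsurj : ∀ i, ∃ x, p x = i := by
    intro i
    obtain ⟨x, -, hx⟩ := Finset.mem_image.1 (e i).2
    exact ⟨x, by simp [p, hx]⟩
  choose q hq using hsurj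
  refine ⟨fun i => g (q i), fun i j hij => (hg _ _).1 ((hp _ _).1 (by rwa [hq, hq])),
    fun x => ?_⟩
  have hx := hq (p x)
  refine le_antisymm (not_lt.1 fun hlt => ?_) (not_lt.1 fun hlt => ?_)
  · exact ((hp _ _).2 ((hg _ _).2 hlt)).ne hx
  · exact ((hp _ _).2 ((hg _ _).2 hlt)).ne hx.symm

namespace SortedLanguage

/-! ### Shapes of tuples in arrays -/

section Shape

variable {I J I' J' I'' J'' : Type*} [LinearOrder I] [LinearOrder J] [LinearOrder I']
  [LinearOrder J'] [LinearOrder I''] [LinearOrder J''] {n : ℕ}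

/-- Two tuples satisfy the same atomic formulas in the language of arrays. -/
def SameShape (η : Fin n → I × J) (ξ : Fin n → I' × J') : Prop :=
  ∀ x y, ((η x).1 < (η y).1 ↔ (ξ x).1 < (ξ y).1) ∧
    ((η x).1 = (η y).1 ∧ (η x).2 < (η y).2 ↔ (ξ x).1 = (ξ y).1 ∧ (ξ x).2 < (ξ y).2)

theorem SameShape.refl (η : Fin n → I × J) : SameShape η η := fun _ _ => ⟨Iff.rfl, Iff.rfl⟩

theorem SameShape.symm {η : Fin n → I × J} {ξ : Fin n → I' × J'} (h : SameShape η ξ) :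
    SameShape ξ η := fun x y => ⟨(h x y).1.symm, (h x y).2.symm⟩

theorem SameShape.trans {η : Fin n → I × J} {ξ : Fin n → I' × J'} {ζ : Fin n → I'' × J''}
    (h : SameShape η ξ) (h' : SameShape ξ ζ) : SameShape η ζ :=
  fun x y => ⟨(h x y).1.trans (h' x y).1, (h x y).2.trans (h' x y).2⟩

/-- Equality is recovered from incomparability: the rows agree because neither is smaller, and then
the same argument applies inside the row. -/
theorem SameShape.eq_of_eq {η : Fin n → I × J} {ξ : Fin n → I' × J'} (h : SameShape η ξ)
    {x y : Fin n} (hxy : η x = η y) : ξ x = ξ y := by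
  have h₁ := h x y
  have h₂ := h y x
  simp only [hxy, lt_irrefl, and_false, false_iff, not_lt, not_and] at h₁ h₂
  have he := le_antisymm h₂.1 h₁.1
  exact Prod.ext he (le_antisymm (h₂.2 he.symm) (h₁.2 he))

theorem SameShape.eq_iff {η : Fin n → I × J} {ξ : Fin n → I' × J'} (h : SameShape η ξ)
    {x y : Fin n} : η x = η y ↔ ξ x = ξ y :=
  ⟨h.eq_of_eq, h.symm.eq_of_eq⟩

theorem sameShape_prodMap {f : I → I'} {g : J → J'} {S : Set I} {T : Set J}
    (hf : StrictMonoOn f S) (hg : StrictMonoOn g T) {η : Fin n → I × J}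
    (hS : ∀ x, (η x).1 ∈ S) (hT : ∀ x, (η x).2 ∈ T) : SameShape η (Prod.map f g ∘ η) :=
  fun x y => ⟨(hf.lt_iff_lt (hS x) (hS y)).symm,
    and_congr (hf.injOn.eq_iff (hS x) (hS y)).symm (hg.lt_iff_lt (hT x) (hT y)).symm⟩

theorem SameQfType.sameShape {η : Fin n → I × J} {ξ : Fin n → I' × J'}
    (h : SameQfType Lar η ξ) : SameShape η ξ := by
  intro x y
  have key : ∀ R : Lar.Relations 2,
      (FirstOrder.Language.Structure.RelMap R ![η x, η y] ↔
        FirstOrder.Language.Structure.RelMap R ![ξ x, ξ y]) := by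
    intro R
    have := h (FirstOrder.Language.Relations.formula₂ R (FirstOrder.Language.Term.var x)
      (FirstOrder.Language.Term.var y))
      (FirstOrder.Language.BoundedFormula.IsAtomic.isQF (.rel _ _))
    simpa only [FirstOrder.Language.Formula.realize_rel₂,
      FirstOrder.Language.Term.realize_var] using this
  exact ⟨key ArRel.lt₁, key ArRel.lt₂⟩

theorem SameShape.realize_iff {η : Fin n → I × J} {ξ : Fin n → I' × J'} (h : SameShape η ξ)
    {θ : Lar.BoundedFormula (Fin n) 0} (hθ : θ.IsQF) :
    θ.Realize η default ↔ θ.Realize ξ default := by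
  -- With no function symbols, every term is a variable.
  have hterm : ∀ t : Lar.Term (Fin n ⊕ Fin 0), ∃ x, t = .var (.inl x) := by
    rintro ((x | i) | ⟨f, _⟩)
    · exact ⟨x, rfl⟩
    · exact i.elim0
    · exact f.elim
  induction hθ with
  | falsum => exact Iff.rfl
  | of_isAtomic ha =>
    cases ha with
    | equal t₁ t₂ =>
      obtain ⟨x, rfl⟩ := hterm t₁
      obtain ⟨y, rfl⟩ := hterm t₂
      exact h.eq_iff
    | rel R ts =>
      choose x hx using fun i => hterm (ts i)
      obtain rfl : ts = fun i => .var (.inl (x i)) := funext hx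
      cases R with
      | lt₁ => exact (h (x 0) (x 1)).1
      | lt₂ => exact (h (x 0) (x 1)).2
  | imp _ _ ih₁ ih₂ => exact imp_congr ih₁ ih₂

theorem sameQfType_iff_sameShape {η : Fin n → I × J} {ξ : Fin n → I' × J'} :
    SameQfType Lar η ξ ↔ SameShape η ξ :=
  ⟨SameQfType.sameShape, fun h _ hθ => h.realize_iff hθ⟩

end Shape

/-! ### Finitely satisfiable sets of indexed formulas -/

variable {L : SortedLanguage.{u}} {M : L.Str} {K : Type u} {σ : K → L.Sorts} {A : M.Params}

namespace IndexedFormula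

variable {I : Type v} {J : Type w}

/-- The formula `φ(x_ξ)`, for `p` the formula `φ(x_η)`. -/
def reindex (p : IndexedFormula M I σ A) (ξ : Fin p.n → J) : IndexedFormula M J σ A :=
  ⟨p.n, ξ, p.φ⟩

theorem exists_formulaOver (p : IndexedFormula M I σ A) :
    ∃ φ : M.FormulaOver (fun q : I × K => σ q.2) A, ∀ a : I → ∀ k, M.carrier (σ k),
      M.SatOver φ (fun q => a q.1 q.2) ↔ p.Holds a := by
  obtain ⟨φ, hφ⟩ := p.φ.exists_rename (τ := M.paramSort (fun q : I × K => σ q.2) A)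
    (Sum.map (Prod.map p.η id) id) (by rintro (q | e) <;> rfl)
  refine ⟨φ, fun a => hφ M _ _ ?_⟩
  rintro (q | e) <;> exact HEq.rfl

/-- A finite set of formulas, projected to the variables in a nonempty tuple. -/
theorem exists_project {q : Set (IndexedFormula M I σ A)} (hq : q.Finite) {n : ℕ} [NeZero n]
    (η : Fin n → I) :
    ∃ ψ : M.FormulaOver (fun z : Fin n × K => σ z.2) A, ∀ a : I → ∀ k, M.carrier (σ k),
      Holds ⟨n, η, ψ⟩ a ↔
        ∃ b : I → ∀ k, M.carrier (σ k), (∀ i, b (η i) = a (η i)) ∧ ∀ p ∈ q, p.Holds b := by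
  choose f hf using fun p : IndexedFormula M I σ A => p.exists_formulaOver
  obtain ⟨χ, hχ⟩ := PosFormula.exists_conj hq.toFinset f
  -- Parameter variables belong to this set vacuously, so they are never quantified away.
  obtain ⟨χ', hχ'⟩ := χ.exists_project {z | ∀ q, z = .inl q → q.1 ∈ Set.range η}
  -- As `η` may repeat an index, `r` picks one position for each. Its value off the range of `η` is
  -- arbitrary, but needs `n ≠ 0`.
  let r : I → Fin n := Function.invFun η
  have hr : ∀ i ∈ Set.range η, η (r i) = i := fun i hi => Function.invFun_eq hi
  obtain ⟨ψ, hψ⟩ := χ'.exists_rename (τ := M.paramSort (fun z : Fin n × K => σ z.2) A)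
    (Sum.map (Prod.map r id) id) (by rintro (q | e) <;> rfl)
  refine ⟨ψ, fun a => ?_⟩
  refine (hψ M (sumAssign (fun z => a (η (r z.1)) z.2) fun e => e.1.2) _ ?_).trans
    ((hχ' M _).trans ⟨?_, ?_⟩)
  · rintro (q | e) <;> exact HEq.rfl
  · rintro ⟨b, hb, hsat⟩
    have hbp : b = sumAssign (fun z : I × K => b (.inl z)) fun e => e.1.2 := by
      funext z
      rcases z with z | e
      · rfl
      · exact hb (.inr e) fun q hq => nomatch hq
    refine ⟨fun i k => b (.inl (i, k)), fun i => funext fun k => ?_, fun p hp => ?_⟩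
    · have := hb (.inl (η i, k)) fun q hq => by
        cases hq
        exact ⟨i, rfl⟩
      refine this.trans ?_
      change a (η (r (η i))) k = a (η i) k
      rw [hr _ ⟨i, rfl⟩]
    · have := (hχ M b).1 hsat p (hq.mem_toFinset.2 hp)
      rw [hbp] at this
      exact (hf p _).1 this
  · rintro ⟨b, hb, hsat⟩
    refine ⟨sumAssign (fun z => b z.1 z.2) fun e => e.1.2, ?_,
      (hχ M _).2 fun p hp => (hf p b).2 (hsat p (hq.mem_toFinset.1 hp))⟩
    rintro (⟨i, k⟩ | e) hz
    · obtain ⟨x, rfl⟩ := hz _ rfl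
      change b (η x) k = a (η (r (η x))) k
      rw [hr _ ⟨x, rfl⟩, hb]
    · rfl

/-- Finite satisfiability of a set of indexed formulas. -/
def FinSat (P : Set (IndexedFormula M I σ A)) : Prop :=
  ∀ q ⊆ P, q.Finite → ∃ a : I → ∀ k, M.carrier (σ k), ∀ p ∈ q, p.Holds a

theorem FinSat.sUnion {c : Set (Set (IndexedFormula M I σ A))} (hc : IsChain (· ⊆ ·) c)
    (hne : c.Nonempty) (h : ∀ P ∈ c, FinSat P) : FinSat (⋃₀ c) := by
  intro q hq hfin
  obtain ⟨P, hP, hqP⟩ := hc.directedOn.exists_mem_subset_of_finite_of_subset_sUnion hne hfin hq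
  exact h P hP q hqP hfin

/-- Zorn with a side condition stable under unions: shape invariance for `P`, nothing for `R`. -/
theorem FinSat.exists_maximal {P : Set (IndexedFormula M I σ A)} (hP : FinSat P)
    (Q : Set (IndexedFormula M I σ A) → Prop) (hPQ : Q P)
    (hQ : ∀ c, (∀ s ∈ c, Q s) → Q (⋃₀ c)) :
    ∃ P', P ⊆ P' ∧ Maximal (fun s => FinSat s ∧ Q s) P' :=
  zorn_subset_nonempty {s | FinSat s ∧ Q s} (fun c hc hchain hne =>
    ⟨⋃₀ c, ⟨FinSat.sUnion hchain hne fun _ hs => (hc hs).1, hQ c fun _ hs => (hc hs).2⟩,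
      fun _ hs => Set.subset_sUnion_of_mem hs⟩) P ⟨hP, hPQ⟩

theorem FinSat.exists_realization {I : Type} [Countable I] {κ : Cardinal.{u}} (hM : M.IsSaturated κ)
    (hκ : Cardinal.aleph0 < κ) (hK : Cardinal.mk K < κ) (hA : Cardinal.mk A < κ)
    {P : Set (IndexedFormula M I σ A)} (hP : FinSat P) :
    ∃ a : I → ∀ k, M.carrier (σ k), ∀ p ∈ P, p.Holds a := by
  choose f hf using fun p : IndexedFormula M I σ A => p.exists_formulaOver
  have hX : Cardinal.mk (I × K) < κ := by
    rw [Cardinal.mk_prod]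
    refine Cardinal.mul_lt_of_lt hκ.le ?_ (by simpa using hK)
    exact (Cardinal.lift_le_aleph0.2 Cardinal.mk_le_aleph0).trans_lt hκ
  obtain ⟨a, ha⟩ := hM (I × K) (fun z => σ z.2) A hX hA (f '' P) fun q hq hfin => by
    obtain ⟨s, hs, hsfin, rfl⟩ :=
      (Set.exists_subset_image_finite_and (p := (q = ·))).1 ⟨q, hq, hfin, rfl⟩
    obtain ⟨a, ha⟩ := hP s hs hsfin
    refine ⟨fun z => a z.1 z.2, ?_⟩
    rintro _ ⟨p, hp, rfl⟩
    exact (hf p a).2 (ha p hp)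
  exact ⟨fun i k => a (i, k), fun p hp => (hf p _).1 (ha _ ⟨p, hp, rfl⟩)⟩

/-- The complement of a maximal finitely satisfiable set is witnessed by its members. -/
theorem exists_separating {P : Set (IndexedFormula M I σ A)}
    (hP : Maximal (fun s => FinSat s ∧ True) P) {n : ℕ} [NeZero n] {η : Fin n → I}
    {φ : M.FormulaOver (fun z : Fin n × K => σ z.2) A} (hφ : ⟨n, η, φ⟩ ∉ P) :
    ∃ ψ : M.FormulaOver (fun z : Fin n × K => σ z.2) A, ⟨n, η, ψ⟩ ∈ P ∧
      ∀ a : I → ∀ k, M.carrier (σ k), ¬ (Holds ⟨n, η, φ⟩ a ∧ Holds ⟨n, η, ψ⟩ a) := by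
  have hins : ∀ p, FinSat (insert p P) → p ∈ P := fun p hp =>
    hP.2 ⟨hp, trivial⟩ (Set.subset_insert p P) (Set.mem_insert p P)
  have hnot := mt (hins _) hφ
  simp only [FinSat, not_forall, not_exists] at hnot
  obtain ⟨q, hq, hfin, hunsat⟩ := hnot
  have hq' : q \ {⟨n, η, φ⟩} ⊆ P := fun p hp => (hq hp.1).resolve_left hp.2
  -- Some finite part of `P` is inconsistent with `φ`; `ψ` says that this part is satisfiable with
  -- the values at `η` kept fixed. It follows from that part, so maximality puts it in `P`.
  obtain ⟨ψ, hψ⟩ := exists_project (hfin.sdiff (t := {⟨n, η, φ⟩})) η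
  refine ⟨ψ, hins _ fun s hs hsfin => ?_, fun a ha => ?_⟩
  · obtain ⟨a, ha⟩ := hP.1.1 ((q \ {⟨n, η, φ⟩}) ∪ (s \ {⟨n, η, ψ⟩}))
      (Set.union_subset hq' fun p hp => (hs hp.1).resolve_left hp.2)
      (hfin.sdiff.union hsfin.sdiff)
    refine ⟨a, fun p hp => ?_⟩
    by_cases hpψ : p = ⟨n, η, ψ⟩
    · subst hpψ
      exact (hψ a).2 ⟨a, fun _ => rfl, fun p hp => ha p (.inl hp)⟩
    · exact ha p (.inr ⟨hp, hpψ⟩)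
  · obtain ⟨b, hb, hsat⟩ := (hψ a).1 ha.2
    obtain ⟨p, hpq, hp⟩ := hunsat b
    by_cases hpφ : p = ⟨n, η, φ⟩
    · subst hpφ
      refine hp ?_
      have h₁ := ha.1
      simp only [Holds] at h₁ ⊢
      simpa only [hb] using h₁
    · exact hp (hsat p ⟨hpq, hpφ⟩)

end IndexedFormula
end SortedLanguage

namespace SortedLanguage

variable {L : SortedLanguage.{u}} {M : L.Str} {K : Type u} {σ : K → L.Sorts} {A : M.Params}

/-! ### Maximal shape-invariant sets -/

/-- Closure under replacing a tuple of indices by one of the same shape. -/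
def ShapeInvariant {I J : Type*} [LinearOrder I] [LinearOrder J]
    (P : Set (IndexedFormula M (I × J) σ A)) : Prop :=
  ∀ p ∈ P, ∀ ξ, SameShape p.η ξ → p.reindex ξ ∈ P

namespace IndexedFormula

/-- A finitely satisfiable shape-invariant set transfers to larger index sets. -/
theorem finSat_transfer {I J : Type*} {Λ : Type v} [LinearOrder I] [LinearOrder J]
    [LinearOrder Λ] {P : Set (IndexedFormula M (I × J) σ A)} (hinv : ShapeInvariant P)
    (hI : ∀ Z : Finset Λ, ∃ f : Λ → I, StrictMonoOn f Z)
    (hJ : ∀ Z : Finset Λ, ∃ f : Λ → J, StrictMonoOn f Z)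
    {b : I × J → ∀ k, M.carrier (σ k)} (hb : ∀ p ∈ P, p.Holds b) :
    FinSat {p : IndexedFormula M (Λ × Λ) σ A |
      ∃ ξ : Fin p.n → I × J, SameShape ξ p.η ∧ p.reindex ξ ∈ P} := by
  classical
  intro q hq hfin
  have hZfin : (⋃ p ∈ q, Set.range (fun x => (p.η x).1) ∪ Set.range fun x => (p.η x).2).Finite :=
    hfin.biUnion fun p _ => (Set.finite_range _).union (Set.finite_range _)
  -- Finitely many formulas involve finitely many coordinates, which embed in `I` and in `J`
  -- preserving order; `b` read through these embeddings is a realisation.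
  obtain ⟨f, hf⟩ := hI hZfin.toFinset
  obtain ⟨g, hg⟩ := hJ hZfin.toFinset
  refine ⟨fun z => b (f z.1, g z.2), fun p hp => ?_⟩
  obtain ⟨ξ, hξ, hmem⟩ := hq hp
  refine hb _ (hinv _ hmem (Prod.map f g ∘ p.η) (hξ.trans (sameShape_prodMap hf hg ?_ ?_)))
  · intro x
    rw [Set.Finite.coe_toFinset]
    exact Set.mem_biUnion hp (.inl ⟨x, rfl⟩)
  · intro x
    rw [Set.Finite.coe_toFinset]
    exact Set.mem_biUnion hp (.inr ⟨x, rfl⟩)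

end IndexedFormula

/-! ### Embedding an array along a chain, and maximality -/

open IndexedFormula

theorem exists_strictMonoOn_nat {Λ : Type*} [LinearOrder Λ] (Z : Finset Λ) :
    ∃ f : Λ → ℕ, StrictMonoOn f Z := by
  classical
  refine ⟨fun x => (Z.filter (· < x)).card, fun x hx y _ hxy => Finset.card_lt_card ?_⟩
  refine (Finset.ssubset_iff_of_subset fun z hz => ?_).2 ⟨x, ?_, by simp⟩
  · rw [Finset.mem_filter] at hz ⊢
    exact ⟨hz.1, hz.2.trans hxy⟩
  · exact Finset.mem_filter.2 ⟨hx, hxy⟩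

/-- The cells of the array `ω × ω`, and the rows themselves, in lexicographic order. -/
def cellCode {n : ℕ} (η : Fin n → ℕ × ℕ) : Fin n ⊕ Fin n → ℕ ×ₗ ℕ
  | .inl x => toLex ((η x).1, 0)
  | .inr x => toLex ((η x).1, (η x).2 + 1)

/-- The code `(i, 0)` of a row comes after all codes from earlier rows and before the codes `(i, j +
1)` of its own cells. Columns are thus compared only within a row, and the shape decides the order
of all codes. -/
theorem SameShape.cellCode_lt_iff {n : ℕ} {η ξ : Fin n → ℕ × ℕ} (h : SameShape η ξ)
    (x y : Fin n ⊕ Fin n) : cellCode η x < cellCode η y ↔ cellCode ξ x < cellCode ξ y := by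
  rcases x with x | x <;> rcases y with y | y <;>
    · have h₁ := h x y
      have h₂ := h y x
      simp only [cellCode, Prod.Lex.toLex_lt_toLex]
      omega

/-- Both coordinates come from one chain, and distinct rows use disjoint blocks of columns; this
reduces the two-dimensional problem to homogeneity for a single linear order. -/
theorem sameShape_cell {Λ : Type*} [LinearOrder Λ] {h : ℕ ×ₗ ℕ → Λ} (hh : StrictMono h) {n : ℕ}
    (η : Fin n → ℕ × ℕ) :
    SameShape η fun x => (h (cellCode η (.inl x)), h (cellCode η (.inr x))) := by
  intro x y
  simp only [hh.lt_iff_lt, hh.injective.eq_iff, cellCode, Prod.Lex.toLex_lt_toLex,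
    toLex_inj, Prod.mk.injEq, and_true]
  omega

theorem mem_of_holds_of_maximal {P : Set (IndexedFormula M (ℕ × ℕ) σ A)}
    (hP : Maximal (fun s => FinSat s ∧ ShapeInvariant s) P)
    {b : ℕ × ℕ → ∀ k, M.carrier (σ k)} (hb : ∀ p ∈ P, p.Holds b) {n : ℕ} [NeZero n]
    {η : Fin n → ℕ × ℕ} {φ : M.FormulaOver (fun z : Fin n × K => σ z.2) A}
    (hφ : Holds ⟨n, η, φ⟩ b) : ⟨n, η, φ⟩ ∈ P := by
  obtain ⟨m, pos, hpos⟩ := exists_strictMono_reindex (cellCode η)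
  obtain ⟨Λ, _, _, hΛ⟩ := exists_homogeneous (ℕ ×ₗ ℕ)
    (Set (M.FormulaOver (fun z : Fin n × K => σ z.2) A)) m
  obtain ⟨R, hPR, hR⟩ := (finSat_transfer (Λ := Λ) hP.1.2 exists_strictMonoOn_nat
    exists_strictMonoOn_nat hb).exists_maximal (fun _ => True) trivial fun _ _ => trivial
  -- The colour of an `m`-tuple is the part of `R` at the cells it codes, arranged in the pattern
  -- `pos` of `η`.
  obtain ⟨h, hh, hhom⟩ := hΛ fun t =>
    {θ | ⟨n, fun x => (t (pos (.inl x)), t (pos (.inr x))), θ⟩ ∈ R}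
  -- The cells of an array which is embedded in `Λ × Λ` along `h`.
  let H : {n : ℕ} → (Fin n → ℕ × ℕ) → Fin n → Λ × Λ := fun ξ x =>
    (h (cellCode ξ (.inl x)), h (cellCode ξ (.inr x)))
  have hH : ∀ {n : ℕ} (ξ : Fin n → ℕ × ℕ), SameShape ξ (H ξ) := fun ξ => sameShape_cell hh ξ
  let P' : Set (IndexedFormula M (ℕ × ℕ) σ A) :=
    {p | ∀ ξ, SameShape p.η ξ → p.reindex (H ξ) ∈ R}
  have hPP' : P ⊆ P' := fun p hp ξ hξ => hPR ⟨p.η, hξ.trans (hH ξ), hp⟩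
  -- `P'` is invariant by construction, and finitely satisfiable because arrays realising finite
  -- parts of `R` restrict to the embedded cells.
  have hP' : P' ⊆ P := by
    refine hP.2 ⟨fun q hq hfin => ?_, fun p hp ξ hξ ζ hζ => hp ζ (hξ.trans hζ)⟩ hPP'
    obtain ⟨a, ha⟩ := hR.1.1 ((fun p => p.reindex (H p.η)) '' q) (by
      rintro _ ⟨p, hp, rfl⟩
      exact hq hp p.η (.refl _)) (hfin.image _)
    exact ⟨fun z => a (h (toLex (z.1, 0)), h (toLex (z.1, z.2 + 1))),
      fun p hp => ha _ ⟨p, hp, rfl⟩⟩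
  have hmem : ∀ θ, ⟨n, H η, θ⟩ ∈ R → ⟨n, η, θ⟩ ∈ P := by
    refine fun θ hθ => hP' fun ξ hξ => ?_
    -- The codes of `η` and of any `ξ` of the same shape are increasing tuples read through the same
    -- `pos`, so homogeneity carries `θ` from one to the other.
    obtain ⟨s, hs, hηs⟩ := hpos (cellCode η) fun _ _ => Iff.rfl
    obtain ⟨t, ht, hξt⟩ := hpos (cellCode ξ) (SameShape.cellCode_lt_iff hξ)
    have := Set.ext_iff.1 (hhom s t hs ht) θ
    simp only [Set.mem_ofPred_eq, Function.comp_apply, ← hηs, ← hξt] at this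
    exact this.1 hθ
  by_cases hφR : ⟨n, H η, φ⟩ ∈ R
  · exact hmem φ hφR
  · obtain ⟨ψ, hψ, hdisj⟩ := exists_separating hR hφR
    have hψb := hb _ (hmem ψ hψ)
    have hfac : (b ∘ η).FactorsThrough (H η) := fun x y hxy =>
      congr_arg b ((hH η).symm.eq_of_eq hxy)
    -- Incompatibility concerns arrays on `Λ × Λ`: place the values of `b` at `η` on the cells `H
    -- η`, which is consistent because equal cells come from equal indices. Values elsewhere play no
    -- role.
    refine (hdisj (Function.extend (H η) (b ∘ η) fun _ => b 0) ?_).elim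
    simp only [Holds, hfac.extend_apply, Function.comp_apply]
    exact ⟨hφ, hψb⟩

/-- The array modelling property, for a saturated structure. -/
theorem exists_stronglyIndiscernible {κ : Cardinal.{u}} (hM : M.IsSaturated κ)
    (hκ : Cardinal.aleph0 < κ) (hK : Cardinal.mk K < κ) (hA : Cardinal.mk A < κ)
    (a : ℕ × ℕ → ∀ k, M.carrier (σ k)) :
    ∃ b : ℕ × ℕ → ∀ k, M.carrier (σ k),
      IsStronglyIndiscernible b A ∧ IsEMBased Lar b a A := by
  obtain ⟨P, hEM, hP⟩ := FinSat.exists_maximal (P := EM Lar a A)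
    (fun q hq _ => ⟨a, fun p hp => hq hp p.η (sameQfType_iff_sameShape.2 (.refl _))⟩)
    ShapeInvariant
    (fun p hp ξ hξ ζ hζ => hp ζ (sameQfType_iff_sameShape.2
      (hξ.trans (sameQfType_iff_sameShape.1 hζ))))
    (fun c hc p ⟨s, hs, hp⟩ ξ hξ => ⟨s, hs, hc s hs p hp ξ hξ⟩)
  obtain ⟨b, hb⟩ := hP.1.1.exists_realization hM hκ hK hA
  refine ⟨b, Set.Subset.antisymm
    (fun p hp => hp p.η (sameQfType_iff_sameShape.2 (.refl _))) ?_, ?_⟩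
  · rintro ⟨n, η, φ⟩ hp ξ hξ
    -- For the empty tuple invariance is trivial, and projection is not available.
    rcases Nat.eq_zero_or_pos n with rfl | hn
    · rwa [Subsingleton.elim ξ η]
    · have : NeZero n := ⟨hn.ne'⟩
      exact hb _ (hP.1.2 _ (mem_of_holds_of_maximal hP hb hp) ξ (sameQfType_iff_sameShape.1 hξ))
  · intro p hp ξ hξ ζ hζ
    exact hb _ (hP.1.2 p (hEM hp) ζ
      ((sameQfType_iff_sameShape.1 hξ).trans (sameQfType_iff_sameShape.1 hζ)))

end SortedLanguage

theorem mainTheorem7 (L : SortedLanguage.{u}) (T : L.PosTheory) (hT : T.JCP)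
    (κ : Cardinal.{u}) (U : L.Str) (hU : T.IsMonster κ U)
    (K : Type u) (hK : Cardinal.mk K < κ) (σ : K → L.Sorts)
    (E : U.Params) (hE : Cardinal.mk E < κ)
    (a : ℕ × ℕ → ∀ k, U.carrier (σ k)) :
    ∃ b : ℕ × ℕ → ∀ k, U.carrier (σ k),
      SortedLanguage.IsStronglyIndiscernible b E ∧
        SortedLanguage.IsEMBased SortedLanguage.Lar b a E :=
  SortedLanguage.exists_stronglyIndiscernible hU.saturated hU.uncountable hK hE a
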